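/- Conventions. A partial function $F:\subseteq\mathbb N^{\mathbb N}\to\mathbb N^{\mathbb N}$ is computable if there is a computable function $h$ on finite words over $\mathbb N$, monotone with respect to the prefix order, such that $F(p)=\sup_{w\sqsubseteq p}h(w)$ for all $p\in\mathrm{dom}(F)$. A represented space is a set $X$ with a partial surjection $\delta_X:\subseteq\mathbb N^{\mathbb N}\to X$. A realizer of a (partial) multi-valued function $f:\subseteq X\rightrightarrows Y$ on represented spaces is an $F:\subseteq\mathbb N^{\mathbb N}\to\mathbb N^{\mathbb N}$ such that, for all $p\in\mathrm{dom}(\delta_X)$ with $\delta_X(p)\in\mathrm{dom}(f)$, $\delta_Y(F(p))$ is defined and lies in $f(\delta_X(p))$; $f$ is computable if it has a computable realizer. A multi-valued function $f$ is Weihrauch reducible to $g$, written $f\leq_{\mathrm W}g$, if there are computable $H,K:\subseteq\mathbb N^{\mathbb N}\to\mathbb N^{\mathbb N}$ such that $p\mapsto H\langle p,G(K(p))\rangle$ is a realizer of $f$ for every realizer $G$ of $g$, where $\langle p,q\rangle(2n)=p(n)$ and $\langle p,q\rangle(2n+1)=q(n)$. Let $\mathsf{LLPO}:\subseteq\mathbb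 N^{\mathbb N}\rightrightarrows\mathbb N$ have as its domain all $p$ with $p(k)\neq 0$ for at most one $k$, with $0\in\mathsf{LLPO}(p)$ iff $p(2n)=0$ for all $n$, $1\in\mathsf{LLPO}(p)$ iff $p(2n+1)=0$ for all $n$, and no other values. Its parallelization $\widehat{\mathsf{LLPO}}:\subseteq\mathbb N^{\mathbb N}\rightrightarrows\mathbb N^{\mathbb N}$ is $\widehat{\mathsf{LLPO}}\langle p_0,p_1,\dots\rangle=\{r:r(i)\in\mathsf{LLPO}(p_i)\text{ for all }i\}$, where $\langle p_0,p_1,\dots\rangle\langle i,n\rangle=p_i(n)$ for a standard computable pairing function on $\mathbb N$, and $\mathbb N^{\mathbb N}$ is represented by the identity. A multi-valued function $f$ on represented spaces is weakly computable if $f\leq_{\mathrm W}\widehat{\mathsf{LLPO}}$. A computable metric space is a metric space $(Y,d)$ with a sequence $\alpha:\mathbb N\to Y$ of dense range such that $(i,j)\mapsto d(\alpha(i),\alpha(j))$ is a computable double sequence of real numbers; it is represented by its Cauchy representation, in which $p$ is a name of $y$ iff $d(\alpha(p(i)),\alpha(p(j)))\leq 2^{-i}$ for all $i<j$ and $\lim_{i\to\infty}\alpha(p(i))=y$.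 Statement. Let $X$ be a represented space and let $Y$ be a computable metric space. Then every weakly computable single-valued partial function $f:\subseteq X\to Y$ is computable. -/

import Mathlib

/-!
Computable analysis over Baire space: computable partial functions on `ℕ → ℕ`, represented
spaces, multi-valued functions and their realizers, Weihrauch reducibility, the parallelization of
the lesser limited principle of omniscience, and computable metric spaces with their Cauchy
representation.
-/

open Filter Topology

universe u v

noncomputable section

namespace TTE

/-- Baire space. -/
abbrev Baire : Type := ℕ → ℕ

/-- The word `p(0) p(1) ... p(n-1)`. -/
def Baire.initSeg (p : Baire) (n : ℕ) : List ℕ := (List.range n).map p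

/-- `Approximates h p q`: the words `h(p[k])`, `k ∈ ℕ`, are prefixes of `q` of unbounded length,
that is, `q` is the supremum of the `h(w)` over all finite prefixes `w` of `p`. -/
def Approximates (h : List ℕ → List ℕ) (p q : Baire) : Prop :=
  (∀ k, h (p.initSeg k) = q.initSeg (h (p.initSeg k)).length) ∧
    ∀ n, ∃ k, n ≤ (h (p.initSeg k)).length

/-- A partial function `F` on Baire space is computable if some computable function `h` on finite
words that is monotone for the prefix order satisfies `F(p) = sup_{w ⊑ p} h(w)` for all
`p ∈ dom F`. -/
def IsComputable (F : Baire →. Baire) : Prop :=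
  ∃ h : List ℕ → List ℕ, Computable h ∧ (∀ u v, u <+: v → h u <+: h v) ∧
    ∀ p q, q ∈ F p → Approximates h p q

/-- The pairing function on Baire space: `⟨p, q⟩(2n) = p(n)` and `⟨p, q⟩(2n+1) = q(n)`. -/
def pairing (p q : Baire) : Baire := fun n => if n % 2 = 0 then p (n / 2) else q (n / 2)

/-- The inverse of the infinite tupling function `⟨p₀, p₁, ...⟩⟨i, n⟩ = pᵢ(n)`. -/
def untuple (p : Baire) : ℕ → Baire := fun i n => p (Nat.pair i n)

/-- The partial function `⟨F, G⟩(p) = ⟨F(p), G(p)⟩`, with domain `dom F ∩ dom G`. -/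
def juxtapose (F G : Baire →. Baire) : Baire →. Baire :=
  fun p => (F p).bind fun q => (G p).map fun r => pairing q r

/-- A representation of `X`: a partial surjection from Baire space onto `X`. -/
structure Representation (X : Type u) where
  toPFun : Baire →. X
  surj : ∀ x, ∃ p, x ∈ toPFun p

/-- Baire space is represented by the identity. -/
def Representation.baire : Representation Baire where
  toPFun := PFun.id Baire
  surj := fun x => ⟨x, by simp [PFun.id]⟩

/-- A (partial) multi-valued function from `X` to `Y`; its domain is `MultiFun.dom`. -/
abbrev MultiFun (X : Type u) (Y : Type v) : Type (max u v) := X → Set Y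

/-- The domain of a multi-valued function. -/
def MultiFun.dom {X : Type u} {Y : Type v} (f : MultiFun X Y) : Set X := {x | (f x).Nonempty}

/-- A partial single-valued function, seen as a multi-valued function. -/
def MultiFun.ofPFun {X : Type u} {Y : Type v} (f : X →. Y) : MultiFun X Y := fun x => {y | y ∈ f x}

/-- `F` is a realizer of `f`: for every name `p` of a point `x` in the domain of `f`, the value
`F(p)` exists and is a name of some point of `f(x)`. -/
def IsRealizer {X : Type u} {Y : Type v} (δX : Representation X) (δY : Representation Y)
    (f : MultiFun X Y) (F : Baire →. Baire) : Prop :=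
  ∀ p x, x ∈ δX.toPFun p → x ∈ f.dom → ∃ q ∈ F p, ∃ y ∈ δY.toPFun q, y ∈ f x

/-- A multi-valued function on represented spaces is computable if it has a computable realizer. -/
def MultiFun.IsComputable {X : Type u} {Y : Type v} (δX : Representation X)
    (δY : Representation Y) (f : MultiFun X Y) : Prop :=
  ∃ F : Baire →. Baire, TTE.IsComputable F ∧ IsRealizer δX δY f F

/-- Weihrauch reducibility of sets of partial functions on Baire space. -/
def SetWeihrauchReducible (𝓕 𝓖 : Set (Baire →. Baire)) : Prop :=
  ∃ H K : Baire →. Baire, IsComputable H ∧ IsComputable K ∧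
    ∀ G ∈ 𝓖, ∃ F ∈ 𝓕, F = H.comp (juxtapose (PFun.id Baire) (G.comp K))

/-- Weihrauch reducibility of multi-valued functions on represented spaces. -/
def WeihrauchReducible {X : Type*} {Y : Type*} {U : Type*} {V : Type*}
    (δX : Representation X) (δY : Representation Y) (f : MultiFun X Y)
    (δU : Representation U) (δV : Representation V) (g : MultiFun U V) : Prop :=
  SetWeihrauchReducible {F | IsRealizer δX δY f F} {G | IsRealizer δU δV g G}

/-- The parallelization `(xᵢ) ↦ f(x₀) × f(x₁) × ...` of a multi-valued function. -/
def MultiFun.parallelization {X : Type u} {Y : Type v} (f : MultiFun X Y) :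
    MultiFun (ℕ → X) (ℕ → Y) :=
  fun x => {y | ∀ i, y i ∈ f (x i)}

/-- The lesser limited principle of omniscience. Its domain is the set of all `p` with
`p(k) ≠ 0` for at most one `k`. -/
def LLPO : MultiFun Baire ℕ := fun p =>
  {i | (∀ k l, p k ≠ 0 → p l ≠ 0 → k = l) ∧
    ((i = 0 ∧ ∀ n, p (2 * n) = 0) ∨ (i = 1 ∧ ∀ n, p (2 * n + 1) = 0))}

/-- The parallelization of `LLPO`, as a multi-valued function on Baire space by means of the
infinite tupling function. -/
def parallelLLPO : MultiFun Baire Baire := fun p => LLPO.parallelization (untuple p)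

/-- A multi-valued function on represented spaces is weakly computable if it is Weihrauch reducible
to the parallelization of `LLPO`. -/
def MultiFun.IsWeaklyComputable {X : Type u} {Y : Type v} (δX : Representation X)
    (δY : Representation Y) (f : MultiFun X Y) : Prop :=
  WeihrauchReducible δX δY f Representation.baire Representation.baire parallelLLPO

/-- A double sequence of real numbers is computable if there is a computable triple sequence of
rational numbers `(a - b) / (c + 1)` that converges to it with error at most `2⁻ᵏ`. -/
def IsComputableDoubleSeq (x : ℕ → ℕ → ℝ) : Prop :=
  ∃ a b c : ℕ × ℕ × ℕ → ℕ, Computable a ∧ Computable b ∧ Computable c ∧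
    ∀ i j k, |x i j - ((a (i, j, k) : ℝ) - (b (i, j, k) : ℝ)) / ((c (i, j, k) : ℝ) + 1)|
      ≤ (1 / 2 : ℝ) ^ k

/-- The structure of a computable metric space on a metric space `Y`: a dense sequence such that
the distances between its members form a computable double sequence. Completeness is not
required. -/
structure ComputableMetric (Y : Type v) [MetricSpace Y] where
  seq : ℕ → Y
  denseRange : DenseRange seq
  computable_dist : IsComputableDoubleSeq fun i j => dist (seq i) (seq j)

variable {Y : Type v} [MetricSpace Y]

/-- `p` is a Cauchy name of `y`: the sequence `α(p(0)), α(p(1)), ...` is rapidly converging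
with limit `y`. -/
def ComputableMetric.IsCauchyName (M : ComputableMetric Y) (p : Baire) (y : Y) : Prop :=
  (∀ i j, i < j → dist (M.seq (p i)) (M.seq (p j)) ≤ (1 / 2 : ℝ) ^ i) ∧
    Tendsto (fun i => M.seq (p i)) atTop (𝓝 y)

/-- The partial function that maps a Cauchy name to the point that it names. -/
def ComputableMetric.cauchyFun (M : ComputableMetric Y) : Baire →. Y :=
  fun p => ⟨∃ y, M.IsCauchyName p y, fun h => h.choose⟩

theorem ComputableMetric.mem_cauchyFun (M : ComputableMetric Y) (p : Baire) (y : Y) :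
    y ∈ M.cauchyFun p ↔ M.IsCauchyName p y := by
  constructor
  · rintro ⟨h, rfl⟩
    exact h.choose_spec
  · intro h
    have h' : ∃ y, M.IsCauchyName p y := ⟨y, h⟩
    exact ⟨h', tendsto_nhds_unique h'.choose_spec.2 h.2⟩

theorem ComputableMetric.exists_isCauchyName (M : ComputableMetric Y) (y : Y) :
    ∃ p, M.IsCauchyName p y := by
  have hd : ∀ n : ℕ, ∃ m, dist y (M.seq m) < (1 / 2 : ℝ) ^ (n + 1) := fun n =>
    M.denseRange.exists_dist_lt y (by positivity)
  choose p hp using hd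
  refine ⟨p, fun i j hij => ?_, ?_⟩
  · have h1 := hp i
    have h2 := hp j
    have h3 : (1 / 2 : ℝ) ^ (j + 1) ≤ (1 / 2 : ℝ) ^ (i + 1) :=
      pow_le_pow_of_le_one (by norm_num) (by norm_num) (by omega)
    have h4 : (1 / 2 : ℝ) ^ (i + 1) = (1 / 2 : ℝ) ^ i / 2 := by ring
    have h5 := dist_triangle_left (M.seq (p i)) (M.seq (p j)) y
    linarith
  · rw [tendsto_iff_dist_tendsto_zero]
    have h0 : Tendsto (fun n : ℕ => (1 / 2 : ℝ) ^ (n + 1)) atTop (𝓝 0) :=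
      (tendsto_pow_atTop_nhds_zero_of_lt_one (by norm_num) (by norm_num)).comp
        (tendsto_add_atTop_nat 1)
    refine squeeze_zero (fun _ => dist_nonneg) (fun n => ?_) h0
    rw [dist_comm]
    exact (hp n).le

/-- The Cauchy representation of a computable metric space. -/
def ComputableMetric.cauchyRep (M : ComputableMetric Y) : Representation Y where
  toPFun := M.cauchyFun
  surj := fun y => (M.exists_isCauchyName y).imp fun p hp => (M.mem_cauchyFun p y).2 hp

end TTE

end

noncomputable section

namespace TTE


/-! Let `H`, `K` witness the reduction, let `p` name `x`, and put `q = K(p)`. The answers `r` to `q`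
form a nonempty closed subset of Cantor space, and any nonzero entry of `q` rules out one digit of
`r`. A reduction must work for every realizer, so each answer `r` makes `H⟨p, r⟩` a Cauchy name; as
`f` is single-valued, all of these name the same point `y`
(`WeihrauchReducible.exists_approximates`).

To compute `y` to precision `n`, search for an index `v` and a stage `m` such that every binary word
of length `m` not yet excluded makes `H` write an entry close to `v`. Such a search terminates by
compactness: a sequence of counterexamples would accumulate at a genuine answer
(`eventually_forces`). A successful search is correct because the initial segment of a genuine
answer is never excluded (`exists_near_of_forces`). `exists_computable_search` turns the test into a
monotone computable word function. -/

theorem computable_forall_lt {α : Type*} [Primcodable α] {f : α → ℕ} {P : α → ℕ → Bool}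
    (hf : Computable f) (hP : Computable₂ P) :
    Computable fun a => decide (∀ s < f a, P a s = true) := by
  have h : Computable fun a =>
      (Nat.rec true (fun k b => b && P a k) (f a) : Bool) :=
    Computable.nat_rec (h := fun a (x : ℕ × Bool) => x.2 && P a x.1) hf (Computable.const true)
      (Primrec.and.to_comp.comp (Computable.snd.comp Computable.snd)
        (hP.comp Computable.fst (Computable.fst.comp Computable.snd)))
  refine h.of_eq fun a => ?_
  generalize f a = n
  induction n with
  | zero => simp
  | succ k ih =>
    simp only [ih, Nat.forall_lt_succ_right, Bool.decide_and, Bool.decide_eq_true]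

/-! ### Finite prefixes of sequences -/

@[simp]
theorem Baire.length_initSeg (p : Baire) (n : ℕ) : (p.initSeg n).length = n := by
  simp [Baire.initSeg]

theorem Baire.getElem?_initSeg (p : Baire) {n k : ℕ} (h : k < n) :
    (p.initSeg n)[k]? = some (p k) := by
  simp [Baire.initSeg, h]

theorem Baire.take_initSeg (p : Baire) {n k : ℕ} (h : k ≤ n) :
    (p.initSeg n).take k = p.initSeg k := by
  simp [Baire.initSeg, ← List.map_take, List.take_range, h]

theorem Baire.initSeg_prefix (p : Baire) {n k : ℕ} (h : k ≤ n) :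
    p.initSeg k <+: p.initSeg n := by
  rw [← p.take_initSeg h]
  exact List.take_prefix _ _

theorem Baire.initSeg_congr {p q : Baire} {n : ℕ} (h : ∀ k < n, p k = q k) :
    p.initSeg n = q.initSeg n := by
  refine List.map_congr_left fun k hk => h k (by simpa using hk)

/-! ### Unbounded search as a monotone word function -/

/-- The words produced from the prefixes of `w` of length at most `k` by searching, for each
position in turn, an entry that passes the test `D`. -/
def searchWord (D : List ℕ → ℕ → ℕ → Bool) (w : List ℕ) (k : ℕ) : List ℕ :=
  Nat.rec [] (fun k o =>
    o ++ bif D (w.take (k + 1)) o.length k.unpair.1 then [k.unpair.1] else []) k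

theorem searchWord_succ (D : List ℕ → ℕ → ℕ → Bool) (w : List ℕ) (k : ℕ) :
    searchWord D w (k + 1) = searchWord D w k ++
      bif D (w.take (k + 1)) (searchWord D w k).length k.unpair.1 then [k.unpair.1] else [] :=
  rfl

theorem searchWord_prefix (D : List ℕ → ℕ → ℕ → Bool) (w : List ℕ) {k l : ℕ} (h : k ≤ l) :
    searchWord D w k <+: searchWord D w l := by
  induction l, h using Nat.le_induction with
  | base => exact List.prefix_rfl
  | succ l _ ih => exact ih.trans (by rw [searchWord_succ]; exact List.prefix_append _ _)

/-- Stage `k` reads only the first `k` letters; this is what makes the search monotone in the input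
word. -/
theorem searchWord_congr (D : List ℕ → ℕ → ℕ → Bool) {w w' : List ℕ} {k : ℕ}
    (h : w.take k = w'.take k) : searchWord D w k = searchWord D w' k := by
  induction k with
  | zero => rfl
  | succ k ih =>
    have h' : w.take k = w'.take k := by
      have := congrArg (List.take k) h
      simpa [List.take_take] using this
    rw [searchWord_succ, searchWord_succ, ih h', h]

theorem computable_searchWord {D : List ℕ → ℕ → ℕ → Bool}
    (hD : Computable fun x : List ℕ × ℕ × ℕ => D x.1 x.2.1 x.2.2) :
    Computable fun w => searchWord D w w.length := by
  have hk : Computable fun x : List ℕ × ℕ × List ℕ => x.2.1.unpair.1 :=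
    (Primrec.fst.comp (Primrec.unpair.comp (Primrec.fst.comp Primrec.snd))).to_comp
  have ho : Computable fun x : List ℕ × ℕ × List ℕ => x.2.2 :=
    Computable.snd.comp Computable.snd
  have hw : Computable fun x : List ℕ × ℕ × List ℕ => x.1.take (x.2.1 + 1) :=
    (Primrec.list_take.comp (Primrec.succ.comp (Primrec.fst.comp Primrec.snd))
      Primrec.fst).to_comp
  refine Computable.nat_rec (h := fun w (x : ℕ × List ℕ) => x.2 ++
      bif D (w.take (x.1 + 1)) x.2.length x.1.unpair.1 then [x.1.unpair.1] else [])
    Computable.list_length (Computable.const []) ?_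
  refine Computable.list_append.comp ho (Computable.cond ?_ ?_ (Computable.const []))
  · exact hD.comp (hw.pair ((Computable.list_length.comp ho).pair hk))
  · exact Computable.list_cons.comp hk (Computable.const [])

theorem exists_eq_initSeg_of_prefix {o : ℕ → List ℕ} (ho : ∀ k l, k ≤ l → o k <+: o l)
    (hl : ∀ n, ∃ k, n ≤ (o k).length) : ∃ q : Baire, ∀ k, o k = q.initSeg (o k).length := by
  choose K hK using hl
  refine ⟨fun n => (o (K (n + 1))).getD n 0, fun k => ?_⟩
  refine List.ext_getElem (by simp) fun n h1 h2 => ?_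
  have h3 : n < (o (K (n + 1))).length := hK (n + 1)
  simp only [Baire.initSeg, List.getElem_map, List.getElem_range]
  rw [List.getD_eq_getElem _ _ h3]
  rcases le_total k (K (n + 1)) with h | h
  · exact (ho _ _ h).getElem h1
  · exact ((ho _ _ h).getElem h3).symm

/-- If every position eventually has an entry that passes the computable test `D` at all later
stages, then a sequence of entries, each of which has passed the test at some stage, can be
computed. -/
theorem exists_computable_search {D : List ℕ → ℕ → ℕ → Bool}
    (hD : Computable fun x : List ℕ × ℕ × ℕ => D x.1 x.2.1 x.2.2) :
    ∃ h : List ℕ → List ℕ, Computable h ∧ (∀ u v, u <+: v → h u <+: h v) ∧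
      ∀ p : Baire, (∀ n, ∃ v, ∀ᶠ m in atTop, D (p.initSeg m) n v = true) →
        ∃ q, Approximates h p q ∧ ∀ n, ∃ m, D (p.initSeg m) n (q n) = true := by
  refine ⟨_, computable_searchWord hD, fun u v huv => ?_, fun p hp => ?_⟩
  · have : searchWord D u u.length = searchWord D v u.length :=
      searchWord_congr D (by
        rw [List.take_length]; exact List.prefix_iff_eq_take.1 huv)
    rw [this]
    exact searchWord_prefix D v huv.length_le
  set o : ℕ → List ℕ := fun k => searchWord D (p.initSeg k) (p.initSeg k).length with ho
  have hs : ∀ k, o (k + 1) = o k ++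
      bif D (p.initSeg (k + 1)) (o k).length k.unpair.1 then [k.unpair.1] else [] := by
    intro k
    have h1 : searchWord D (p.initSeg (k + 1)) k = searchWord D (p.initSeg k) k :=
      searchWord_congr D (by
        rw [p.take_initSeg k.le_succ, p.take_initSeg le_rfl])
    simp only [ho, Baire.length_initSeg]
    rw [searchWord_succ, h1, p.take_initSeg le_rfl]
  have hmono : ∀ k l, k ≤ l → o k <+: o l := by
    intro k l hkl
    induction l, hkl using Nat.le_induction with
    | base => exact List.prefix_rfl
    | succ l _ ih => exact ih.trans (by rw [hs]; exact List.prefix_append _ _)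
  have hlen : ∀ n, ∃ k, n ≤ (o k).length := by
    intro n
    induction n with
    | zero => exact ⟨0, Nat.zero_le _⟩
    | succ n ih =>
      obtain ⟨k, hk⟩ := ih
      obtain ⟨v, hv⟩ := hp n
      obtain ⟨M, hM⟩ := eventually_atTop.1 hv
      -- Every candidate recurs as the first component of arbitrarily large codes, so `v` is tried
      -- again after stage `M`, when it passes for good. Either position `n` has been filled by
      -- then, or `v` fills it.
      set l := Nat.pair v (max k M) with hl
      have h1 : max k M ≤ l := Nat.right_le_pair _ _
      have h2 := (hk.trans (hmono k l (by omega)).length_le)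
      rcases h2.lt_or_eq with h3 | h3
      · exact ⟨l, h3⟩
      · refine ⟨l + 1, ?_⟩
        have h4 : l.unpair.1 = v := by simp [hl]
        rw [hs, ← h3, h4, hM (l + 1) (by omega)]
        simp [← h3]
  have hpass : ∀ k n, ∀ h : n < (o k).length, ∃ m, D (p.initSeg m) n ((o k)[n]) = true := by
    intro k
    induction k with
    | zero => intro n h; exact absurd h (by simp [ho, searchWord])
    | succ k ih =>
      intro n h
      by_cases h1 : n < (o k).length
      · obtain ⟨m, hm⟩ := ih n h1
        refine ⟨m, ?_⟩
        rwa [← (hmono k (k + 1) k.le_succ).getElem h1]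
      · cases hb : D (p.initSeg (k + 1)) (o k).length k.unpair.1 with
        | false =>
          rw [hs, hb] at h
          simp at h
          exact absurd h h1
        | true =>
          have h2 := hs k
          rw [hb, cond_true] at h2
          have h3 : n = (o k).length := by
            rw [h2, List.length_append, List.length_singleton] at h
            omega
          subst h3
          refine ⟨k + 1, ?_⟩
          simpa [h2] using hb
  obtain ⟨q, hq⟩ := exists_eq_initSeg_of_prefix hmono hlen
  refine ⟨q, ⟨hq, hlen⟩, fun n => ?_⟩
  obtain ⟨k, hk⟩ := hlen (n + 1)
  obtain ⟨m, hm⟩ := hpass k n hk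
  refine ⟨m, ?_⟩
  have h1 : (o k)[n]? = some (q n) := by
    rw [hq k]; exact q.getElem?_initSeg hk
  rwa [(List.getElem_eq_iff hk).2 h1] at hm


/-! ### `LLPO` and Weihrauch reductions -/

theorem mem_LLPO_iff {p : Baire} {i : ℕ} : i ∈ LLPO p ↔
    (∀ k l, p k ≠ 0 → p l ≠ 0 → k = l) ∧ i < 2 ∧ ∀ n, p n ≠ 0 → i ≠ n % 2 := by
  refine and_congr_right fun _ => ⟨?_, ?_⟩
  · rintro (⟨rfl, h⟩ | ⟨rfl, h⟩)
    · refine ⟨by norm_num, fun n hn hi => hn ?_⟩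
      rw [show n = 2 * (n / 2) by omega, h]
    · refine ⟨by norm_num, fun n hn hi => hn ?_⟩
      rw [show n = 2 * (n / 2) + 1 by omega, h]
  · rintro ⟨hi, h⟩
    interval_cases i
    · exact Or.inl ⟨rfl, fun n => by_contra fun hn => h _ hn (by omega)⟩
    · exact Or.inr ⟨rfl, fun n => by_contra fun hn => h _ hn (by omega)⟩

/-- A realizer may be altered at one point, so a reduction has to cope with each possible answer. -/
theorem exists_isRealizer_mem {g : MultiFun Baire Baire} {q r : Baire} (hr : r ∈ g q) :
    ∃ G, IsRealizer Representation.baire Representation.baire g G ∧ G q = Part.some r := by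
  classical
  refine ⟨fun q' => if q' = q then Part.some r else ⟨(g q').Nonempty, fun h => h.choose⟩,
    fun p x hx hd => ?_, if_pos rfl⟩
  have hxp : x = p := by simpa [Representation.baire, PFun.id] using hx
  subst hxp
  by_cases h : x = q
  · subst h
    exact ⟨r, by simp, r, by simp [Representation.baire, PFun.id], hr⟩
  · refine ⟨hd.choose, ?_, hd.choose, by simp [Representation.baire, PFun.id], hd.choose_spec⟩
    simp only [h, if_false]
    exact Part.mem_mk_iff.2 ⟨hd, rfl⟩

/-- A realizer undefined outside the domain of `g` forces a reduction to ask only legitimate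
questions. -/
theorem exists_isRealizer_dom (g : MultiFun Baire Baire) :
    ∃ G, IsRealizer Representation.baire Representation.baire g G ∧
      ∀ q r, r ∈ G q → r ∈ g q := by
  refine ⟨fun q => ⟨(g q).Nonempty, fun h => h.choose⟩, fun p x hx hd => ?_, ?_⟩
  · have hxp : x = p := by simpa [Representation.baire, PFun.id] using hx
    subst hxp
    exact ⟨hd.choose, Part.mem_mk_iff.2 ⟨hd, rfl⟩, hd.choose,
      by simp [Representation.baire, PFun.id], hd.choose_spec⟩
  · rintro q r ⟨h, rfl⟩
    exact h.choose_spec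

theorem mem_comp_juxtapose_iff {H G K : Baire →. Baire} {p z : Baire} :
    z ∈ (H.comp (juxtapose (PFun.id Baire) (G.comp K))) p ↔
      ∃ q ∈ K p, ∃ r ∈ G q, z ∈ H (pairing p r) := by
  constructor
  · intro h
    obtain ⟨_, h1, hz⟩ := Part.mem_bind_iff.1 h
    obtain ⟨_, h2, h1⟩ := Part.mem_bind_iff.1 h1
    obtain rfl := Part.mem_some_iff.1 h2
    obtain ⟨r, h3, rfl⟩ := (Part.mem_map_iff _).1 h1
    obtain ⟨q, hq, hr⟩ := Part.mem_bind_iff.1 h3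
    exact ⟨q, hq, r, hr, hz⟩
  · rintro ⟨q, hq, r, hr, hz⟩
    exact Part.mem_bind_iff.2 ⟨_, Part.mem_bind_iff.2 ⟨p, Part.mem_some p,
      (Part.mem_map_iff _).2 ⟨r, Part.mem_bind_iff.2 ⟨q, hq, hr⟩, rfl⟩⟩, hz⟩

theorem WeihrauchReducible.exists_approximates {X : Type u} {Y : Type v}
    {δX : Representation X} {δY : Representation Y} {f : X →. Y} {g : MultiFun Baire Baire}
    (hf : WeihrauchReducible δX δY (MultiFun.ofPFun f) Representation.baire Representation.baire
      g) :
    ∃ hH hK : List ℕ → List ℕ, Computable hH ∧ Computable hK ∧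
      (∀ u v, u <+: v → hH u <+: hH v) ∧ (∀ u v, u <+: v → hK u <+: hK v) ∧
      ∀ p x y, x ∈ δX.toPFun p → y ∈ f x → ∃ q, Approximates hK p q ∧ (g q).Nonempty ∧
        ∀ r ∈ g q, ∃ z, Approximates hH (pairing p r) z ∧ y ∈ δY.toPFun z := by
  obtain ⟨H, K, ⟨hH, cH, mH, aH⟩, ⟨hK, cK, mK, aK⟩, h⟩ := hf
  refine ⟨hH, hK, cH, cK, mH, mK, fun p x y hx hy => ?_⟩
  have key : ∀ G, IsRealizer Representation.baire Representation.baire g G →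
      ∃ q ∈ K p, ∃ r ∈ G q, ∃ z ∈ H (pairing p r), y ∈ δY.toPFun z := by
    intro G hG
    obtain ⟨F, hF, rfl⟩ := h G hG
    obtain ⟨z, hz, y', hy', hfy⟩ := hF p x hx ⟨y, hy⟩
    obtain ⟨q, hq, r, hr, hz⟩ := mem_comp_juxtapose_iff.1 hz
    -- Single-valuedness of `f` enters here: the named point does not depend on `G`.
    obtain rfl := Part.mem_unique hy hfy
    exact ⟨q, hq, r, hr, z, hz, hy'⟩
  obtain ⟨G₀, hG₀, hdom⟩ := exists_isRealizer_dom g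
  obtain ⟨q, hq, r₀, hr₀, -⟩ := key G₀ hG₀
  refine ⟨q, aK p q hq, ⟨r₀, hdom q r₀ hr₀⟩, fun r hr => ?_⟩
  obtain ⟨G, hG, hGq⟩ := exists_isRealizer_mem hr
  obtain ⟨q', hq', r', hr', z, hz, hy'⟩ := key G hG
  obtain rfl := Part.mem_unique hq hq'
  rw [hGq, Part.mem_some_iff] at hr'
  subst hr'
  exact ⟨z, aH _ z hz, hy'⟩

/-! ### Binary words coded by numbers, and the forcing test -/

/-- The `i`-th binary digit of `s`. -/
def binaryDigit (s i : ℕ) : ℕ := s / 2 ^ i % 2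

theorem exists_binaryDigit_eq {r : Baire} (hr : ∀ i, r i < 2) (m : ℕ) :
    ∃ s < 2 ^ m, ∀ i < m, binaryDigit s i = r i := by
  refine ⟨Nat.ofBits fun i : Fin m => decide (r i = 1), Nat.ofBits_lt_two_pow _,
    fun i hi => ?_⟩
  rw [binaryDigit, ← Nat.toNat_testBit, Nat.testBit_ofBits_lt _ _ hi]
  have := hr i
  interval_cases r i <;> simp

theorem primrec_pow : Primrec₂ ((· ^ ·) : ℕ → ℕ → ℕ) := Primrec₂.unpaired'.1 Nat.Primrec.pow

theorem primrec_binaryDigit : Primrec₂ binaryDigit := by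
  exact Primrec.nat_mod.comp
    (Primrec.nat_div.comp Primrec.fst (primrec_pow.comp (Primrec.const 2) Primrec.snd))
    (Primrec.const 2)

/-- The prefix of length `2 |w|` of `⟨w, r⟩`, where `r` is the sequence of binary digits of `s`. -/
def pairingWord (w : List ℕ) (s : ℕ) : List ℕ :=
  (List.range (2 * w.length)).map fun k =>
    bif k % 2 == 0 then w.getD (k / 2) 0 else binaryDigit s (k / 2)

theorem primrec_pairingWord : Primrec₂ pairingWord := by
  have hk : Primrec fun x : (List ℕ × ℕ) × ℕ => x.2 / 2 :=
    Primrec.nat_div.comp Primrec.snd (Primrec.const 2)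
  refine Primrec.list_map
    (Primrec.list_range.comp
      (Primrec.nat_mul.comp (Primrec.const 2) (Primrec.list_length.comp Primrec.fst)))
    (Primrec.cond (Primrec.beq.comp (Primrec.nat_mod.comp Primrec.snd (Primrec.const 2))
      (Primrec.const 0)) ?_ ?_)
  · exact (Primrec.list_getD 0).comp (Primrec.fst.comp Primrec.fst) hk
  · exact primrec_binaryDigit.comp (Primrec.snd.comp Primrec.fst) hk

theorem pairingWord_initSeg {p r : Baire} {m s : ℕ} (h : ∀ i < m, binaryDigit s i = r i) :
    pairingWord (p.initSeg m) s = (pairing p r).initSeg (2 * m) := by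
  unfold pairingWord
  rw [Baire.length_initSeg,
    show (pairing p r).initSeg (2 * m) = (List.range (2 * m)).map (pairing p r) from rfl]
  refine List.map_congr_left fun k hk => ?_
  have hk' : k / 2 < m := by have := List.mem_range.1 hk; omega
  unfold pairing
  rw [List.getD_eq_getElem?_getD, p.getElem?_initSeg hk', h _ hk']
  by_cases h0 : k % 2 = 0
  · simp [h0]
  · simp [h0, beq_eq_false_iff_ne.2 h0]

/-- The first `m` entries of the word `q` do not exclude that the sequence of binary digits of `s`
is a value of the parallelization of `LLPO`. -/
def consistent (q : List ℕ) (m s : ℕ) : Bool :=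
  decide (∀ t < m, (q.getD t 0 == 0 || !(binaryDigit s t.unpair.1 == t.unpair.2 % 2)) = true)

/-- The default `0` means that entries of `q` not yet written exclude nothing. -/
theorem consistent_iff {q : List ℕ} {m s : ℕ} : consistent q m s = true ↔
    ∀ t < m, q.getD t 0 ≠ 0 → binaryDigit s t.unpair.1 ≠ t.unpair.2 % 2 := by
  simp only [consistent, decide_eq_true_eq, Bool.or_eq_true, beq_iff_eq, Bool.not_eq_true',
    beq_eq_false_iff_ne, ne_eq, or_iff_not_imp_left]

theorem computable_consistent :
    Computable fun x : List ℕ × ℕ × ℕ => consistent x.1 x.2.1 x.2.2 := by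
  refine computable_forall_lt (Computable.fst.comp Computable.snd) (Primrec.to_comp ?_)
  have ht : Primrec fun x : (List ℕ × ℕ × ℕ) × ℕ => x.2.unpair :=
    Primrec.unpair.comp Primrec.snd
  refine Primrec.or.comp (Primrec.beq.comp ?_ (Primrec.const 0))
    (Primrec.not.comp (Primrec.beq.comp ?_ ?_))
  · exact (Primrec.list_getD 0).comp (Primrec.fst.comp Primrec.fst) Primrec.snd
  · exact primrec_binaryDigit.comp (Primrec.snd.comp (Primrec.snd.comp Primrec.fst))
      (Primrec.fst.comp ht)
  · exact Primrec.nat_mod.comp (Primrec.snd.comp ht) (Primrec.const 2)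

/-- The computable test on words that forces values: every sequence of binary digits consistent
with the answers requested by `hK` makes `hH` produce an entry at position `n + 4` that passes the
test `near n · v`. -/
def forces (hH hK : List ℕ → List ℕ) (near : ℕ → ℕ → ℕ → Bool) (w : List ℕ) (n v : ℕ) : Bool :=
  decide (∀ s < 2 ^ w.length, (!consistent (hK w) w.length s ||
    ((hH (pairingWord w s))[n + 4]?.map fun j => near n j v).getD false) = true)

/-- Here the default is `false`: an entry that `hH` has not yet written counts as a failure. -/
theorem forces_iff {hH hK : List ℕ → List ℕ} {near : ℕ → ℕ → ℕ → Bool} {w : List ℕ} {n v : ℕ} :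
    forces hH hK near w n v = true ↔ ∀ s < 2 ^ w.length, consistent (hK w) w.length s = true →
      ∃ j, (hH (pairingWord w s))[n + 4]? = some j ∧ near n j v = true := by
  simp only [forces, decide_eq_true_eq]
  refine forall₂_congr fun s _ => ?_
  cases consistent (hK w) w.length s <;> cases (hH (pairingWord w s))[n + 4]? <;> simp

theorem computable_forces {hH hK : List ℕ → List ℕ} {near : ℕ → ℕ → ℕ → Bool}
    (cH : Computable hH) (cK : Computable hK)
    (cn : Computable fun x : ℕ × ℕ × ℕ => near x.1 x.2.1 x.2.2) :
    Computable fun x : List ℕ × ℕ × ℕ => forces hH hK near x.1 x.2.1 x.2.2 := by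
  have hb : Computable fun x : List ℕ × ℕ × ℕ => 2 ^ x.1.length :=
    (primrec_pow.comp (Primrec.const 2) (Primrec.list_length.comp Primrec.fst)).to_comp
  have hw : Computable fun x : (List ℕ × ℕ × ℕ) × ℕ => x.1.1 :=
    Computable.fst.comp Computable.fst
  have hn : Computable fun x : (List ℕ × ℕ × ℕ) × ℕ => x.1.2.1 :=
    Computable.fst.comp (Computable.snd.comp Computable.fst)
  have hv : Computable fun x : (List ℕ × ℕ × ℕ) × ℕ => x.1.2.2 :=
    Computable.snd.comp (Computable.snd.comp Computable.fst)
  have hn4 : Computable fun x : (List ℕ × ℕ × ℕ) × ℕ => x.1.2.1 + 4 :=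
    (Primrec.nat_add.to_comp).comp hn (Computable.const 4)
  have hq : Computable fun x : (List ℕ × ℕ × ℕ) × ℕ => (hK x.1.1, x.1.1.length, x.2) :=
    (cK.comp hw).pair ((Computable.list_length.comp hw).pair Computable.snd)
  have hu : Computable fun x : (List ℕ × ℕ × ℕ) × ℕ => hH (pairingWord x.1.1 x.2) :=
    cH.comp (primrec_pairingWord.to_comp.comp hw Computable.snd)
  have hj : Computable fun x : ((List ℕ × ℕ × ℕ) × ℕ) × ℕ => (x.1.1.2.1, x.2, x.1.1.2.2) :=
    (hn.comp Computable.fst).pair (Computable.snd.pair (hv.comp Computable.fst))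
  have h1 : Computable fun x : (List ℕ × ℕ × ℕ) × ℕ =>
      consistent (hK x.1.1) x.1.1.length x.2 :=
    (computable_consistent.comp hq :)
  have h2 : Computable fun x : (List ℕ × ℕ × ℕ) × ℕ =>
      (hH (pairingWord x.1.1 x.2))[x.1.2.1 + 4]? :=
    Computable.list_getElem?.comp hu hn4
  have h3 : Computable₂ fun (x : (List ℕ × ℕ × ℕ) × ℕ) j => near x.1.2.1 j x.1.2.2 :=
    (cn.comp hj :)
  have h4 : Computable₂ fun (x : List ℕ × ℕ × ℕ) s => (!consistent (hK x.1) x.1.length s ||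
      ((hH (pairingWord x.1 s))[x.2.1 + 4]?.map fun j => near x.2.1 j x.2.2).getD false) :=
    Primrec.or.to_comp.comp (Primrec.not.to_comp.comp h1)
      (Computable.option_getD (Computable.option_map h2 h3) (Computable.const false))
  exact computable_forall_lt hb h4


/-! ### Soundness of the test, and its eventual success by compactness -/

theorem Approximates.exists_getElem? {h : List ℕ → List ℕ} {p q : Baire}
    (hpq : Approximates h p q) (n : ℕ) : ∃ k, (h (p.initSeg k))[n]? = some (q n) := by
  obtain ⟨k, hk⟩ := hpq.2 (n + 1)
  exact ⟨k, by rw [hpq.1 k]; exact q.getElem?_initSeg hk⟩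

theorem Approximates.getElem?_eq {h : List ℕ → List ℕ} {p q : Baire}
    (hpq : Approximates h p q) {k n j : ℕ} (hj : (h (p.initSeg k))[n]? = some j) : j = q n := by
  have hn : n < (h (p.initSeg k)).length := (List.getElem?_eq_some_iff.1 hj).1
  rw [hpq.1 k, q.getElem?_initSeg hn] at hj
  exact (Option.some.inj hj).symm

theorem getElem?_of_prefix {l l' : List ℕ} (h : l <+: l') {n j : ℕ} (hj : l[n]? = some j) :
    l'[n]? = some j := by
  obtain ⟨t, rfl⟩ := h
  rw [List.getElem?_append_left (List.getElem?_eq_some_iff.1 hj).1, hj]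

theorem mem_parallelLLPO_iff {q r : Baire} : r ∈ parallelLLPO q ↔
    (∀ i k l, untuple q i k ≠ 0 → untuple q i l ≠ 0 → k = l) ∧ (∀ i, r i < 2) ∧
      ∀ t, q t ≠ 0 → r t.unpair.1 ≠ t.unpair.2 % 2 := by
  have h : r ∈ parallelLLPO q ↔ ∀ i, r i ∈ LLPO (untuple q i) := Iff.rfl
  simp only [h, mem_LLPO_iff, forall_and]
  refine and_congr_right fun _ => and_congr_right fun _ => ⟨fun h t ht => ?_, fun h i n hn => ?_⟩
  · exact h _ _ (by rwa [untuple, Nat.pair_unpair])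
  · simpa using h _ hn

theorem consistent_of_mem {hK : List ℕ → List ℕ} {p q r : Baire} (hq : Approximates hK p q)
    (hr : r ∈ parallelLLPO q) {m s : ℕ} (hs : ∀ i < m, binaryDigit s i = r i) :
    consistent (hK (p.initSeg m)) m s = true := by
  refine consistent_iff.2 fun t ht h0 => ?_
  -- Position `t < m` concerns the instance `t.unpair.1 ≤ t`, whose digit is among the first `m`.
  rw [hs _ ((Nat.unpair_left_le t).trans_lt ht)]
  refine (mem_parallelLLPO_iff.1 hr).2.2 t ?_
  cases hj : (hK (p.initSeg m))[t]? with
  | none => simp [List.getD_eq_getElem?_getD, hj] at h0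
  | some j =>
    rw [← hq.getElem?_eq hj]
    simpa [List.getD_eq_getElem?_getD, hj] using h0

/-- The first `m` digits of the answer `r` form one of the words over which the test quantifies. -/
theorem exists_near_of_forces {hH hK : List ℕ → List ℕ} {near : ℕ → ℕ → ℕ → Bool}
    {p q r z : Baire} (hq : Approximates hK p q) (hr : r ∈ parallelLLPO q)
    (hz : Approximates hH (pairing p r) z) {m n v : ℕ}
    (h : forces hH hK near (p.initSeg m) n v = true) : near n (z (n + 4)) v = true := by
  obtain ⟨s, hs, hsr⟩ := exists_binaryDigit_eq (mem_parallelLLPO_iff.1 hr).2.1 m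
  have h' := forces_iff.1 h s
  rw [Baire.length_initSeg] at h'
  obtain ⟨j, hj, hnear⟩ := h' hs (consistent_of_mem hq hr hsr)
  rw [pairingWord_initSeg hsr] at hj
  rwa [← hz.getElem?_eq hj]

theorem eventually_forces {hH hK : List ℕ → List ℕ} {near : ℕ → ℕ → ℕ → Bool}
    (mH : ∀ u v, u <+: v → hH u <+: hH v) (mK : ∀ u v, u <+: v → hK u <+: hK v)
    {p q : Baire} {n v : ℕ} (hq : Approximates hK p q) (hne : (parallelLLPO q).Nonempty)
    (h : ∀ r ∈ parallelLLPO q,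
      ∃ z, Approximates hH (pairing p r) z ∧ near n (z (n + 4)) v = true) :
    ∀ᶠ m in atTop, forces hH hK near (p.initSeg m) n v = true := by
  by_contra hcon
  obtain ⟨φ, hφ, hbad⟩ := extraction_of_frequently_atTop (not_eventually.1 hcon)
  have hbad' : ∀ k, ∃ s, consistent (hK (p.initSeg (φ k))) (φ k) s = true ∧
      ∀ j, (hH (pairingWord (p.initSeg (φ k)) s))[n + 4]? = some j → ¬ near n j v = true := by
    intro k
    have := hbad k
    rw [forces_iff] at this
    push Not at this
    obtain ⟨s, -, h1, h2⟩ := this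
    rw [Baire.length_initSeg] at h1
    exact ⟨s, h1, h2⟩
  choose s hcons hnot using hbad'
  -- Sequential compactness of `ℕ → Bool`: the digit sequences of the counterexamples subconverge to
  -- some `b`.
  obtain ⟨b, ψ, hψ, hlim⟩ :=
    CompactSpace.tendsto_subseq fun k => fun i => decide (binaryDigit (s k) i = 1)
  have hdig : ∀ k i, binaryDigit (s k) i < 2 := fun k i => Nat.mod_lt _ (by norm_num)
  set r : Baire := fun i => (b i).toNat with hrdef
  have hev : ∀ i, ∀ᶠ k in atTop, binaryDigit (s (ψ k)) i = r i := by
    intro i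
    have h1 := (tendsto_pi_nhds.1 hlim i).eventually (eventually_of_mem
      ((isOpen_discrete {b i}).mem_nhds rfl) fun _ hx => hx)
    filter_upwards [h1] with k hk
    have hk' : decide (binaryDigit (s (ψ k)) i = 1) = b i := hk
    have := hdig (ψ k) i
    simp only [hrdef, ← hk']
    interval_cases binaryDigit (s (ψ k)) i <;> rfl
  have hlarge : Tendsto (fun k => φ (ψ k)) atTop atTop :=
    hφ.tendsto_atTop.comp hψ.tendsto_atTop
  have hr : r ∈ parallelLLPO q := by
    obtain ⟨r₀, hr₀⟩ := hne
    -- The domain condition depends on `q` alone, so any answer `r₀` supplies it.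
    refine mem_parallelLLPO_iff.2 ⟨(mem_parallelLLPO_iff.1 hr₀).1, fun i => ?_, fun t ht => ?_⟩
    · exact Bool.toNat_lt _
    · obtain ⟨k₀, hk₀⟩ := hq.exists_getElem? t
      obtain ⟨k, hk1, hk2, hk3⟩ := ((hev t.unpair.1).and
        ((hlarge.eventually_ge_atTop k₀).and (hlarge.eventually_gt_atTop t))).exists
      rw [← hk1]
      refine consistent_iff.1 (hcons (ψ k)) t hk3 ?_
      rw [List.getD_eq_getElem?_getD,
        getElem?_of_prefix (mK _ _ (p.initSeg_prefix hk2)) hk₀]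
      exact ht
  obtain ⟨z, hz, hnear⟩ := h r hr
  obtain ⟨k₀, hk₀⟩ := hz.exists_getElem? (n + 4)
  have hall : ∀ᶠ k in atTop, ∀ i ∈ Finset.range k₀, binaryDigit (s (ψ k)) i = r i :=
    (Filter.eventually_all_finset _).2 fun i _ => hev i
  obtain ⟨k, hk1, hk2⟩ := (hall.and (hlarge.eventually_ge_atTop k₀)).exists
  refine hnot (ψ k) _ ?_ hnear
  rw [pairingWord_initSeg (r := binaryDigit (s (ψ k))) fun i _ => rfl]
  refine getElem?_of_prefix (mH _ _ ?_) hk₀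
  -- The entry for the limit `r` depends on finitely many digits, which a late counterexample
  -- shares; it would then pass the test.
  have hcongr : (pairing p r).initSeg k₀ = (pairing p (binaryDigit (s (ψ k)))).initSeg k₀ := by
    refine Baire.initSeg_congr fun i hi => ?_
    unfold pairing
    rw [hk1 (i / 2) (Finset.mem_range.2 (by omega))]
  rw [hcongr]
  exact Baire.initSeg_prefix _ (by omega)

/-! ### Approximate distance tests and Cauchy names -/

variable {Y : Type v} [MetricSpace Y]

/-- Comparison of reals is undecidable, so with `ε = 2^-(n+4)` an `ε`-approximation of the distance
is compared with `4ε`; this leaves the gap between `3ε` and `5ε`. -/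
theorem ComputableMetric.exists_near (M : ComputableMetric Y) : ∃ near : ℕ → ℕ → ℕ → Bool,
    (Computable fun x : ℕ × ℕ × ℕ => near x.1 x.2.1 x.2.2) ∧
      (∀ n i j, near n i j = true → dist (M.seq i) (M.seq j) ≤ 5 * (1 / 2 : ℝ) ^ (n + 4)) ∧
      ∀ n i j, dist (M.seq i) (M.seq j) ≤ 3 * (1 / 2 : ℝ) ^ (n + 4) → near n i j = true := by
  obtain ⟨a, b, c, ca, cb, cc, h⟩ := M.computable_dist
  -- Clearing denominators and moving the subtracted term across gives an inequality decidable in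
  -- `ℕ`.
  have hiff : ∀ n t : ℕ, ∀ x y : ℝ, (x - y) / ((t : ℝ) + 1) ≤ 4 * (1 / 2 : ℝ) ^ (n + 4) ↔
      x * 2 ^ (n + 2) ≤ y * 2 ^ (n + 2) + (t + 1) := by
    intro n t x y
    have h1 : (0 : ℝ) < 2 ^ (n + 2) := by positivity
    have h2 : 4 * (1 / 2 : ℝ) ^ (n + 4) = 1 / 2 ^ (n + 2) := by
      rw [one_div_pow, pow_add, pow_add]; field_simp; norm_num
    rw [h2, div_le_div_iff₀ (by positivity) h1, sub_mul, sub_le_iff_le_add, one_mul,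
      add_comm ((t : ℝ) + 1)]
  refine ⟨fun n i j => decide (a (i, j, n + 4) * 2 ^ (n + 2) ≤
    b (i, j, n + 4) * 2 ^ (n + 2) + (c (i, j, n + 4) + 1)), ?_, fun n i j hn => ?_,
    fun n i j hd => ?_⟩
  · have hs : Computable fun x : ℕ × ℕ × ℕ => (x.2.1, x.2.2, x.1 + 4) :=
      (Primrec.pair (Primrec.fst.comp Primrec.snd) (Primrec.pair (Primrec.snd.comp Primrec.snd)
        (Primrec.nat_add.comp Primrec.fst (Primrec.const 4)))).to_comp
    have hp : Computable fun x : ℕ × ℕ × ℕ => 2 ^ (x.1 + 2) :=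
      (primrec_pow.comp (Primrec.const 2)
        (Primrec.nat_add.comp Primrec.fst (Primrec.const 2))).to_comp
    have hmul := Primrec.nat_mul.to_comp
    have hle : Computable₂ fun x y : ℕ => decide (x ≤ y) := Primrec.nat_le.decide.to_comp
    exact hle.comp (hmul.comp (ca.comp hs) hp) (Primrec.nat_add.to_comp.comp
      (hmul.comp (cb.comp hs) hp) (Computable.succ.comp (cc.comp hs)))
  · have h1 := (hiff n (c (i, j, n + 4)) (a (i, j, n + 4)) (b (i, j, n + 4))).2
      (by exact_mod_cast of_decide_eq_true hn)
    have h2 := (abs_le.1 (h i j (n + 4))).2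
    linarith
  · refine decide_eq_true ?_
    have h2 := (abs_le.1 (h i j (n + 4))).1
    have h1 := (hiff n (c (i, j, n + 4)) (a (i, j, n + 4)) (b (i, j, n + 4))).1 (by linarith)
    exact_mod_cast h1

theorem ComputableMetric.IsCauchyName.dist_le {M : ComputableMetric Y} {p : Baire} {y : Y}
    (h : M.IsCauchyName p y) (n : ℕ) : dist (M.seq (p n)) y ≤ (1 / 2 : ℝ) ^ n :=
  le_of_tendsto (tendsto_const_nhds.dist h.2)
    ((eventually_gt_atTop n).mono fun j hj => h.1 n j hj)

theorem ComputableMetric.isCauchyName_of_dist_le {M : ComputableMetric Y} {p : Baire} {y : Y}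
    (h : ∀ n, dist (M.seq (p n)) y ≤ (1 / 2 : ℝ) ^ (n + 1)) : M.IsCauchyName p y := by
  refine ⟨fun i j hij => ?_, ?_⟩
  · have h3 : (1 / 2 : ℝ) ^ (j + 1) ≤ (1 / 2 : ℝ) ^ (i + 1) :=
      pow_le_pow_of_le_one (by norm_num) (by norm_num) (by omega)
    have h4 : (1 / 2 : ℝ) ^ (i + 1) = (1 / 2 : ℝ) ^ i / 2 := by ring
    linarith [h i, h j, dist_triangle_right (M.seq (p i)) (M.seq (p j)) y]
  · rw [tendsto_iff_dist_tendsto_zero]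
    exact squeeze_zero (fun _ => dist_nonneg) h
      ((tendsto_pow_atTop_nhds_zero_of_lt_one (by norm_num) (by norm_num)).comp
        (tendsto_add_atTop_nat 1))

theorem Approximates.unique {h : List ℕ → List ℕ} {p q q' : Baire} (hq : Approximates h p q)
    (hq' : Approximates h p q') : q = q' := by
  funext n
  obtain ⟨k, hk⟩ := hq.exists_getElem? n
  exact hq'.getElem?_eq hk

/-- The partial function on Baire space computed by `h`. -/
def supFun (h : List ℕ → List ℕ) : Baire →. Baire :=
  fun p => ⟨∃ q, Approximates h p q, fun hp => hp.choose⟩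

theorem mem_supFun_iff {h : List ℕ → List ℕ} {p q : Baire} :
    q ∈ supFun h p ↔ Approximates h p q := by
  constructor
  · rintro ⟨hp, rfl⟩
    exact hp.choose_spec
  · intro hq
    have hp : ∃ q, Approximates h p q := ⟨q, hq⟩
    exact ⟨hp, hp.choose_spec.unique hq⟩

end TTE

end


/-! ### Weakly computable single-valued functions are computable -/

theorem mainTheorem3 {X : Type u} {Y : Type v} [MetricSpace Y]
    (δX : TTE.Representation X) (M : TTE.ComputableMetric Y) (f : X →. Y)
    (hf : (TTE.MultiFun.ofPFun f).IsWeaklyComputable δX M.cauchyRep) :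
    (TTE.MultiFun.ofPFun f).IsComputable δX M.cauchyRep := by
  obtain ⟨hH, hK, cH, cK, mH, mK, hred⟩ := TTE.WeihrauchReducible.exists_approximates hf
  obtain ⟨near, cn, hnear, hnear'⟩ := M.exists_near
  obtain ⟨h, ch, mh, hh⟩ := TTE.exists_computable_search (TTE.computable_forces cH cK cn)
  refine ⟨TTE.supFun h, ⟨h, ch, mh, fun p q hq => TTE.mem_supFun_iff.1 hq⟩, fun p x hx hd => ?_⟩
  obtain ⟨y, hy⟩ := hd
  obtain ⟨q, hq, hne, hr⟩ := hred p x y hx hy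
  have hr' : ∀ r ∈ TTE.parallelLLPO q, ∃ z, TTE.Approximates hH (TTE.pairing p r) z ∧
      M.IsCauchyName z y := fun r hrq =>
    (hr r hrq).imp fun z hz => ⟨hz.1, (M.mem_cauchyFun z y).1 hz.2⟩
  obtain ⟨o, ho, hpass⟩ := hh p fun n => by
    obtain ⟨v, hv⟩ := M.denseRange.exists_dist_lt y
      (show (0 : ℝ) < (1 / 2 : ℝ) ^ (n + 4) by positivity)
    refine ⟨v, TTE.eventually_forces mH mK hq hne fun r hrq => ?_⟩
    obtain ⟨z, hz, hzy⟩ := hr' r hrq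
    refine ⟨z, hz, hnear' _ _ _ ?_⟩
    -- With `ε = 2^-(n+4)`, both points are within `ε` of `y`, and `2ε ≤ 3ε`.
    linarith [hzy.dist_le (n + 4), dist_triangle (M.seq (z (n + 4))) y (M.seq v),
      show (0 : ℝ) < (1 / 2 : ℝ) ^ (n + 4) by positivity]
  refine ⟨o, TTE.mem_supFun_iff.2 ho, y, (M.mem_cauchyFun o y).2 ?_, hy⟩
  refine TTE.ComputableMetric.isCauchyName_of_dist_le fun n => ?_
  obtain ⟨m, hm⟩ := hpass n
  obtain ⟨r, hrq⟩ := hne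
  obtain ⟨z, hz, hzy⟩ := hr' r hrq
  have h1 := hnear _ _ _ (TTE.exists_near_of_forces hq hrq hz hm)
  have h2 := hzy.dist_le (n + 4)
  have h3 := dist_triangle_left (M.seq (o n)) y (M.seq (z (n + 4)))
  -- The total error is at most `5ε + ε`, below the allowed `8ε = 2^-(n+1)`.
  have h4 : (1 / 2 : ℝ) ^ (n + 1) = 8 * (1 / 2 : ℝ) ^ (n + 4) := by ring
  have h5 : (0 : ℝ) < (1 / 2 : ℝ) ^ (n + 4) := by positivity
  linarith
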